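/- For a finite simple graph $G$ and nonempty vertex sets $A,B$, let $d(A,B)=e(A,B)/(|A||B|)$, where $e(A,B)$ is the number of pairs $(a,b)\in A\times B$ such that $ab$ is an edge of $G$. The pair $(A,B)$ is $\varepsilon$-regular if $|d(A,B)-d(A',B')|\le\varepsilon$ for all $A'\subseteq A$ and $B'\subseteq B$ with $|A'|\ge\varepsilon|A|$ and $|B'|\ge\varepsilon|B|$. An equipartition of $G$ is a partition of its vertex set into nonempty sets $Z_1,\dots,Z_k$ whose sizes differ pairwise by at most $1$; its order is $k$. It is $\varepsilon$-nice if for every part $Z$, for all but at most $\varepsilon k$ of the parts $Z'$ (where $Z'=Z$ is allowed) the pair $(Z,Z')$ is $\varepsilon$-regular. For $x\ge 0$ let $\mathrm{twr}(x)$ be the tower of twos of height $\lceil x\rceil$, that is, $\mathrm{twr}(0)=1$, $\mathrm{twr}(h+1)=2^{\mathrm{twr}(h)}$ for integers $h\ge 0$, and $\mathrm{twr}(x)=\mathrm{twr}(\lceil x\rceil)$. Theorem. There is an absolute constant $c>0$ such that for every $0<\varepsilon<c$ there is a finite simple graph $G$ such that every $\varepsilon$-nice equipartition of $G$ has order at least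 $\mathrm{twr}(c/\varepsilon^{1/2})$. Equivalently, if $M'$ is an integer such that every finite graph has an $\varepsilon$-nice equipartition of order at most $M'$, then $M'\ge\mathrm{twr}(c/\varepsilon^{1/2})$. -/

import Mathlib

/-- The pair `(A, B)` is `ε`-regular in `G`: `|d(A, B) - d(A', B')| ≤ ε` for all `A' ⊆ A` and
`B' ⊆ B` with `|A'| ≥ ε |A|` and `|B'| ≥ ε |B|`. (Mathlib's `SimpleGraph.IsUniform` has `< ε`.) -/
def IsRegularPair {V : Type*} (G : SimpleGraph V) [DecidableRel G.Adj] (ε : ℝ)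
    (A B : Finset V) : Prop :=
  ∀ A' ⊆ A, ∀ B' ⊆ B, ε * (A.card : ℝ) ≤ A'.card → ε * (B.card : ℝ) ≤ B'.card →
    |(G.edgeDensity A B : ℝ) - (G.edgeDensity A' B' : ℝ)| ≤ ε

/-- A partition of the vertex set into `k` parts is an `ε`-nice equipartition of `G` if the sizes of
its parts differ by at most one and, for every part `Z`, all but at most `ε k` of the parts `Z'`
are such that `(Z, Z')` is `ε`-regular. -/
def IsNiceEquipartition {V : Type*} [Fintype V] [DecidableEq V] (G : SimpleGraph V)
    [DecidableRel G.Adj] (ε : ℝ) (P : Finpartition (Finset.univ : Finset V)) : Prop :=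
  P.IsEquipartition ∧
    ∀ Z ∈ P.parts,
      (({Z' | Z' ∈ P.parts ∧ ¬ IsRegularPair G ε Z Z'} : Set (Finset V)).ncard : ℝ) ≤ ε * (P.parts.card : ℝ)

/-- The tower of twos of height `n`. -/
def towerNat : ℕ → ℕ
  | 0 => 1
  | n + 1 => 2 ^ towerNat n

/-- The tower of twos of real height `x`, rounded up to an integer height. -/
noncomputable def twr (x : ℝ) : ℕ := towerNat ⌈x⌉₊

/-! The graph hides a chain of h ≈ ε^(-1/2) refining vertex partitions whose orders grow like a
tower. A class of level i+1 is a class of level i together with a codeword that has one bit per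
class of level i. Vertices over u and v are joined with density 1/2 + s(u,v)/(4h), where s adds one
sign per level: + if the bit of u's codeword at v's class equals the bit of v's codeword at u's
class. Fix u and keep the half of a level-i class y whose bit at u's class is 1. Coarser signs are
then constant, finer signs cancel because each bit is balanced over the code, and the level-i sign
is the bit of u at y (`exists_hierarchical_graph`).

By induction on i, every part of a nice equipartition lies in a class of level i up to a fraction
32εi (`IsNiceEquipartition.exists_near_containment`). If a part Z fails at level i+1, its codewords
are spread out. Codewords are far apart, so a constant fraction of the coordinates y cut Z into two
substantial pieces (`card_div_le_card_splitting`). Their degrees into half of y differ by 2δ, in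
total by order n/h. Regularity of Z with most parts, each nearly inside one class, allows only O(ε +
εi)n. This is contradictory while h²ε is small, whence the exponent 1/2. Finally, parts mostly
inside level-h classes must be at least half as numerous as those classes. -/

open Finset

/-! ### Balanced codes with linear minimum distance -/

/-- The weighted count of Boolean words by their agreements with `v`. -/
lemma sum_eight_pow_agreements {k : ℕ} (v : Fin k → Bool) :
    ∑ u : Fin k → Bool, 8 ^ #{y | u y = v y} = 9 ^ k := by
  have h1 : ∀ u : Fin k → Bool, 8 ^ #{y | u y = v y} = ∏ y, if u y = v y then 8 else 1 := by
    intro u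
    rw [Finset.prod_ite]
    simp
  have h2 : ∏ y : Fin k, ∑ b : Bool, (if b = v y then 8 else 1) = 9 ^ k := by
    rw [Finset.prod_congr rfl (g := fun _ => 9)]
    · simp
    · intro y _
      cases v y <;> simp
  rw [Finset.sum_congr rfl (fun u _ => h1 u), ← h2, Finset.prod_univ_sum]
  exact Finset.sum_congr (by ext; simp) fun _ _ => rfl

/-- A bound on the size of a Hamming ball. -/
lemma card_hamming_ball_mul_le {k : ℕ} (t : ℕ) (v : Fin k → Bool) :
    #{u : Fin k → Bool | #{y | u y ≠ v y} ≤ t} * 8 ^ (k - t) ≤ 9 ^ k := by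
  rw [← sum_eight_pow_agreements v, ← smul_eq_mul, ← Finset.sum_const]
  refine (Finset.sum_le_sum fun u hu => ?_).trans
    (Finset.sum_le_sum_of_subset (Finset.subset_univ _))
  have hu' : #{y | u y ≠ v y} ≤ t := (Finset.mem_filter.1 hu).2
  have h := Finset.card_filter_add_card_filter_not (s := (univ : Finset (Fin k)))
    (fun y => u y = v y)
  rw [Finset.card_univ, Fintype.card_fin] at h
  exact Nat.pow_le_pow_right (by norm_num) (by simp only [ne_eq] at hu'; omega)

/-- Makes fewer than 2 ^ t pairs of Hamming balls too small to cover the cube. The case k = 8t rests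
on 4 * 9 ^ 8 ≤ 2 ^ 29; each further coordinate costs 9 ≤ 16. -/
lemma two_mul_sixteen_pow_mul_nine_pow_le {k t : ℕ} (ht : 0 < t) (hk : 8 * t ≤ k) :
    2 * 2 ^ t * 9 ^ k ≤ 2 ^ k * 8 ^ (k - t) := by
  obtain ⟨d, rfl⟩ := Nat.exists_eq_add_of_le hk
  have e : 8 * t + d - t = 7 * t + d := by omega
  rw [e]
  have h1 : 2 * 2 ^ t * 9 ^ (8 * t) ≤ 2 ^ (8 * t) * 8 ^ (7 * t) := by
    rw [pow_mul, pow_mul, pow_mul, ← mul_pow]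
    obtain ⟨s, rfl⟩ := Nat.exists_eq_add_of_le' ht
    calc 2 * 2 ^ (s + 1) * (9 ^ 8) ^ (s + 1) = (2 * 9 ^ 8) ^ s * (4 * 9 ^ 8) := by
          rw [mul_pow]; ring
      _ ≤ (2 ^ 8 * 8 ^ 7) ^ s * (2 ^ 8 * 8 ^ 7) := 
          Nat.mul_le_mul (Nat.pow_le_pow_left (by norm_num) _) (by norm_num)
      _ = _ := by ring
  have h2 : 9 ^ d ≤ 2 ^ d * 8 ^ d := by
    rw [← mul_pow]; gcongr; norm_num
  calc 2 * 2 ^ t * 9 ^ (8 * t + d) = (2 * 2 ^ t * 9 ^ (8 * t)) * 9 ^ d := by ring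
    _ ≤ (2 ^ (8 * t) * 8 ^ (7 * t)) * (2 ^ d * 8 ^ d) := Nat.mul_le_mul h1 h2
    _ = _ := by ring

/-- A greedily chosen code in which any two words both differ and agree in more than an eighth of
the coordinates. -/
lemma exists_code_finset (k N : ℕ) (hN : N ≤ 2 ^ (k / 8)) :
    ∃ S : Finset (Fin k → Bool), #S = N ∧ ∀ u ∈ S, ∀ v ∈ S, u ≠ v →
      k / 8 < #{y | u y ≠ v y} ∧ k / 8 < #{y | u y = v y} := by
  classical
  induction N with
  | zero => exact ⟨∅, by simp⟩
  | succ N ih =>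
    obtain ⟨S, hS, hsep⟩ := ih (by omega)
    set t := k / 8 with ht
    have key : ∃ u : Fin k → Bool, ∀ v ∈ S,
        t < #{y | u y ≠ v y} ∧ t < #{y | u y = v y} := by
      by_contra! hcon
      -- A word that cannot be added lies within t of a chosen word or of its complement.
      have hcover : (univ : Finset (Fin k → Bool)) ⊆ S.biUnion fun v =>
          ({u : Fin k → Bool | #{y | u y ≠ v y} ≤ t} : Finset _) ∪
            ({u : Fin k → Bool | #{y | u y ≠ !(v y)} ≤ t} : Finset _) := by
        intro u _
        obtain ⟨v, hv, h⟩ := hcon u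
        refine Finset.mem_biUnion.2 ⟨v, hv, ?_⟩
        rw [Finset.mem_union, Finset.mem_filter, Finset.mem_filter]
        by_cases h1 : #{y | u y ≠ v y} ≤ t
        · exact Or.inl ⟨mem_univ _, h1⟩
        · have h2 := h (not_le.1 h1)
          simp only [ne_eq, Bool.not_eq_not]
          exact Or.inr ⟨mem_univ _, h2⟩
      have hcard := Finset.card_le_card hcover
      rw [Finset.card_univ, Fintype.card_fun, Fintype.card_bool, Fintype.card_fin] at hcard
      have hb : 2 ^ k * 8 ^ (k - t) ≤ N * (2 * 9 ^ k) := by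
        calc 2 ^ k * 8 ^ (k - t) ≤ _ := Nat.mul_le_mul_right _ hcard
          _ ≤ (∑ v ∈ S, 2 * (9 ^ k / 8 ^ (k - t))) * 8 ^ (k - t) := by
            gcongr
            refine Finset.card_biUnion_le.trans (Finset.sum_le_sum fun v _ => ?_)
            refine (Finset.card_union_le _ _).trans ?_
            rw [two_mul]
            gcongr <;> rw [Nat.le_div_iff_mul_le (by positivity)]
            · exact card_hamming_ball_mul_le t v
            · exact card_hamming_ball_mul_le t fun y => !(v y)
          _ = N * (2 * (9 ^ k / 8 ^ (k - t) * 8 ^ (k - t))) := by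
            rw [Finset.sum_const, hS, smul_eq_mul]; ring
          _ ≤ _ := by gcongr; exact Nat.div_mul_le_self _ _
      rcases Nat.eq_zero_or_pos t with h0 | h0
      -- The numerical lemma needs t > 0; for t = 0 no word has been chosen yet, so nothing is
      -- covered.
      · rw [h0, pow_zero] at hN
        have : N = 0 := by omega
        rw [this, zero_mul] at hb
        have : 0 < 2 ^ k * 8 ^ (k - t) := by positivity
        omega
      · have h3 := two_mul_sixteen_pow_mul_nine_pow_le (k := k) h0 (by omega)
        have h4 : (N + 1) * (2 * 9 ^ k) ≤ 2 ^ t * (2 * 9 ^ k) := Nat.mul_le_mul_right _ hN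
        have h5 : 0 < 9 ^ k := by positivity
        nlinarith
    obtain ⟨u, hu⟩ := key
    refine ⟨insert u S, ?_, ?_⟩
    · rw [Finset.card_insert_of_notMem, hS]
      intro h
      have := (hu u h).1
      simp at this
    · intro a ha b hb hab
      rcases Finset.mem_insert.1 ha with ha' | ha' <;> rcases Finset.mem_insert.1 hb with hb' | hb'
      · exact absurd (ha'.trans hb'.symm) hab
      · rw [ha']; exact hu b hb'
      · rw [hb']; simpa only [ne_comm, eq_comm] using hu a ha'
      · exact hsep a ha' b hb' hab

/-- A code closed under complementation with linear minimum distance. -/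
lemma exists_balanced_code (k : ℕ) (hk : 0 < k) :
    ∃ σ : Fin (2 ^ (k / 8) * 2) → Fin k → Bool,
      (∀ y, #{c | σ c y = true} = #{c | σ c y = false}) ∧
      ∀ c c', c ≠ c' → k ≤ 8 * #{y | σ c y ≠ σ c' y} := by
  classical
  obtain ⟨S, hS, hsep⟩ := exists_code_finset k _ le_rfl
  have e : Fin (2 ^ (k / 8) * 2) ≃ S × Bool :=
    Fintype.equivOfCardEq (by simp [hS])
  -- Each word is taken with its complement, which balances every coordinate. Separation from
  -- complements is why the chosen words also had to agree often.
  refine ⟨fun c y => xor ((e c).1.1 y) (e c).2, fun y => ?_, fun c c' hcc => ?_⟩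
  · refine Finset.card_bij (fun c _ => e.symm ((e c).1, !(e c).2)) ?_ ?_ ?_
    · intro c hc
      simp only [mem_filter, mem_univ, true_and, Equiv.apply_symm_apply] at hc ⊢
      revert hc
      cases (e c).1.1 y <;> cases (e c).2 <;> simp
    · intro c _ c' _ h
      apply e.injective
      have := e.symm.injective h
      rw [Prod.mk.injEq] at this
      exact Prod.ext this.1 (by simpa using this.2)
    · intro c hc
      refine ⟨e.symm ((e c).1, !(e c).2), ?_, by simp⟩
      simp only [mem_filter, mem_univ, true_and, Equiv.apply_symm_apply] at hc ⊢
      revert hc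
      cases (e c).1.1 y <;> cases (e c).2 <;> simp
  · have hd : (e c).1 = (e c').1 → (e c).2 ≠ (e c').2 := fun h h' =>
      hcc (e.injective (Prod.ext h h'))
    simp only
    generalize e c = p at hd ⊢
    generalize e c' = p' at hd ⊢
    obtain ⟨u, b⟩ := p
    obtain ⟨u', b'⟩ := p'
    simp only at hd ⊢
    by_cases hu : u = u'
    · have hb := hd hu
      rw [Finset.filter_true_of_mem (fun y _ => by simp [hu, hb]), card_univ, Fintype.card_fin]
      omega
    · have h := hsep u.1 u.2 u'.1 u'.2 (fun h => hu (Subtype.ext h))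
      by_cases hb : b = b'
      · rw [Finset.filter_congr (q := fun y => u.1 y ≠ u'.1 y) (fun y _ => by simp [hb])]
        omega
      · rw [Finset.filter_congr (q := fun y => u.1 y = u'.1 y)]
        · omega
        · intro y _
          revert hb
          cases b <;> cases b' <;> cases u.1 y <;> cases u'.1 y <;> simp

/-! ### Splitting a mass distribution by a code -/

/-- If any two codewords differ in at least an eighth of the coordinates, a mass distribution on the
codewords with no atom carrying almost everything is split substantially by at least a
thirty-second of the coordinates. -/
lemma card_div_le_card_splitting {K C : Type*} [Fintype K] [Fintype C] [Nonempty C]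
    [DecidableEq C] (σ : C → K → Bool)
    (hsep : ∀ c c', c ≠ c' → Fintype.card K ≤ 8 * #{y | σ c y ≠ σ c' y})
    (μ : C → ℝ) (hμ : ∀ c, 0 ≤ μ c) (r : ℝ) (hr : 0 < r) (hmax : ∀ c, μ c + r ≤ ∑ c, μ c) :
    (Fintype.card K : ℝ) / 32 ≤ #{y | r / 32 ≤ ∑ c with σ c y = true, μ c ∧
      r / 32 ≤ ∑ c with σ c y = false, μ c} := by
  classical
  obtain ⟨c₀, hc₀⟩ := Finite.exists_max μ
  set m := ∑ c, μ c with hm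
  set r₀ := m - μ c₀ with hr₀
  have hrr : r ≤ r₀ := by have := hmax c₀; linarith
  have hm0 : 0 < m := by have := hmax c₀; have := hμ c₀; linarith
  set p : K → ℝ := fun y => ∑ c with σ c y = true, μ c with hp
  set f : K → ℝ := fun y => ∑ c with σ c y = false, μ c with hf
  have hp0 : ∀ y, 0 ≤ p y := fun y => Finset.sum_nonneg fun c _ => hμ c
  have hf0 : ∀ y, 0 ≤ f y := fun y => Finset.sum_nonneg fun c _ => hμ c
  have hpf : ∀ y, p y + f y = m := by
    intro y
    have := Finset.sum_filter_add_sum_filter_not univ (fun c => σ c y = true) μ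
    simpa only [Bool.not_eq_true] using this
  -- The side of y without the heaviest codeword has mass at most r₀.
  have hq : ∀ y, p y * f y ≤ m * r₀ := by
    intro y
    have h1 := hpf y
    cases hb : σ c₀ y
    · have : μ c₀ ≤ f y := Finset.single_le_sum (f := μ) (fun c _ => hμ c) (by simp [hb])
      rw [mul_comm]
      exact mul_le_mul (by linarith [hp0 y]) (by linarith) (hp0 y) hm0.le
    · have : μ c₀ ≤ p y := Finset.single_le_sum (f := μ) (fun c _ => hμ c) (by simp [hb])
      exact mul_le_mul (by linarith [hf0 y]) (by linarith) (hf0 y) hm0.le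
  -- The weight of ordered pairs of codewords separated by y; each distinct pair is separated by an
  -- eighth of the coordinates.
  have hpair : ∀ y, 2 * (p y * f y) =
      ∑ c, ∑ c', μ c * μ c' * (if σ c y ≠ σ c' y then 1 else 0) := by
    intro y
    have e1 : p y * f y = ∑ c, ∑ c', (if σ c y = true then μ c else 0) *
        (if σ c' y = false then μ c' else 0) := by
      rw [← Finset.sum_mul_sum, ← Finset.sum_filter, ← Finset.sum_filter]
    have e2 : f y * p y = ∑ c, ∑ c', (if σ c y = false then μ c else 0) *
        (if σ c' y = true then μ c' else 0) := by
      rw [← Finset.sum_mul_sum, ← Finset.sum_filter, ← Finset.sum_filter]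
    rw [two_mul]
    nth_rewrite 2 [mul_comm]
    rw [e1, e2, ← Finset.sum_add_distrib]
    refine Finset.sum_congr rfl fun c _ => ?_
    rw [← Finset.sum_add_distrib]
    refine Finset.sum_congr rfl fun c' _ => ?_
    cases σ c y <;> cases σ c' y <;> simp
  have hsum : (Fintype.card K : ℝ) / 8 * (m * r₀) ≤ ∑ y, 2 * (p y * f y) := by
    rw [Finset.sum_congr rfl fun y _ => hpair y, Finset.sum_comm, hm, Finset.sum_mul,
      Finset.mul_sum]
    refine Finset.sum_le_sum fun c _ => ?_
    rw [Finset.sum_comm]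
    have h1 : ∀ c', μ c * μ c' * (if c = c' then 0 else (Fintype.card K : ℝ) / 8) ≤
        ∑ y, μ c * μ c' * (if σ c y ≠ σ c' y then 1 else 0) := by
      intro c'
      rw [← Finset.mul_sum, Finset.sum_boole]
      refine mul_le_mul_of_nonneg_left ?_ (mul_nonneg (hμ _) (hμ _))
      split_ifs with h
      · positivity
      · have : (Fintype.card K : ℝ) ≤ 8 * (#{y | σ c y ≠ σ c' y} : ℝ) := by
          exact_mod_cast hsep c c' h
        linarith
    refine le_trans ?_ (Finset.sum_le_sum fun c' _ => h1 c')
    have h2 : ∑ c', μ c * μ c' * (if c = c' then 0 else (Fintype.card K : ℝ) / 8) =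
        μ c * (Fintype.card K / 8) * (m - μ c) := by
      have : ∀ c', μ c * μ c' * (if c = c' then 0 else (Fintype.card K : ℝ) / 8) =
          μ c * (Fintype.card K / 8) * (μ c' - if c = c' then μ c' else 0) := by
        intro c'; split_ifs <;> ring
      rw [Finset.sum_congr rfl fun c' _ => this c', ← Finset.mul_sum, Finset.sum_sub_distrib]
      simp [hm]
    rw [h2]
    have h3 : r₀ ≤ m - μ c := by have := hc₀ c; linarith
    calc (Fintype.card K : ℝ) / 8 * (μ c * r₀) = μ c * (Fintype.card K / 8) * r₀ := by ring
      _ ≤ _ := mul_le_mul_of_nonneg_left h3 (mul_nonneg (hμ c) (by positivity))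
  set good : Finset K := {y | r / 32 ≤ p y ∧ r / 32 ≤ f y} with hgood
  have hup : ∑ y, p y * f y ≤ #good * (m * r₀) + Fintype.card K * (m * r₀ / 32) := by
    have h1 : ∀ y, p y * f y ≤ (if y ∈ good then m * r₀ else 0) + m * r₀ / 32 := by
      intro y
      have hmr : 0 ≤ m * r₀ := mul_nonneg hm0.le (hr.le.trans hrr)
      split_ifs with h
      · linarith [hq y]
      · rw [hgood, mem_filter, not_and_or, not_and_or] at h
        have hy := hpf y
        have hp1 := hp0 y
        have hf1 := hf0 y
        rcases h with h | h | h
        · exact absurd (mem_univ _) h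
        · have : p y * f y ≤ (r₀ / 32) * m :=
            mul_le_mul (by linarith) (by linarith) hf1 (by linarith)
          linarith
        · have : p y * f y ≤ m * (r₀ / 32) :=
            mul_le_mul (by linarith) (by linarith) hf1 hm0.le
          linarith
    refine (Finset.sum_le_sum fun y _ => h1 y).trans (le_of_eq ?_)
    rw [Finset.sum_add_distrib, ← Finset.sum_filter, Finset.sum_const, Finset.sum_const]
    simp
  rw [← Finset.mul_sum] at hsum
  have hmr : 0 < m * r₀ := mul_pos hm0 (hr.trans_le hrr)
  -- Half of 1/8 from the lower bound, less the 1/32 from unsplit coordinates, leaves 1/32.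
  have : (Fintype.card K : ℝ) / 32 * (m * r₀) ≤ #good * (m * r₀) := by linarith
  exact le_of_mul_le_mul_right this hmr

/-! ### Density differences and regular pairs -/

section Density

variable {V : Type*} (G : SimpleGraph V) [DecidableRel G.Adj]

lemma edgeDensity_mul_card (A S : Finset V) :
    (G.edgeDensity A S : ℝ) * #S = ∑ w ∈ S, (#{a ∈ A | G.Adj a w} : ℝ) / #A := by
  have h : (#(G.interedges A S) : ℝ) = ∑ w ∈ S, (#{a ∈ A | G.Adj a w} : ℝ) := by
    rw [SimpleGraph.interedges_def, Finset.card_filter, Finset.sum_product_right]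
    push_cast
    exact Finset.sum_congr rfl fun w _ => by rw [Finset.card_filter]; push_cast; rfl
  rcases S.eq_empty_or_nonempty with rfl | hS
  · simp
  · have : (#S : ℝ) ≠ 0 := by exact_mod_cast hS.card_pos.ne'
    rw [← Finset.sum_div, ← h]
    simp only [SimpleGraph.edgeDensity, Rel.edgeDensity, SimpleGraph.interedges]
    push_cast
    field_simp

/-- The difference of the densities from `w` to `A` and to `B`. -/
noncomputable def codensityDiff (A B : Finset V) (w : V) : ℝ :=
  (#{a ∈ A | G.Adj a w} : ℝ) / #A - (#{b ∈ B | G.Adj b w} : ℝ) / #B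

lemma codensityDiff_le_one (A B : Finset V) (w : V) : codensityDiff G A B w ≤ 1 := by
  have h1 : (#{a ∈ A | G.Adj a w} : ℝ) / #A ≤ 1 :=
    div_le_one_of_le₀ (by exact_mod_cast Finset.card_filter_le _ _) (by positivity)
  have h2 : 0 ≤ (#{b ∈ B | G.Adj b w} : ℝ) / #B := by positivity
  rw [codensityDiff]; linarith

lemma sum_codensityDiff_le_card (A B S : Finset V) :
    ∑ w ∈ S, codensityDiff G A B w ≤ #S := by
  refine (Finset.sum_le_sum fun w _ => codensityDiff_le_one G A B w).trans ?_
  simp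

/-- Double counting of edges turns the sum over W into the average degree from A minus that from B.
-/
lemma sum_codensityDiff_eq {A B W : Finset V} (hA : A.Nonempty) (hB : B.Nonempty) {b δ : ℝ}
    (h1 : ∀ u ∈ A, (#{v ∈ W | G.Adj u v} : ℝ) = b + δ)
    (h2 : ∀ u ∈ B, (#{v ∈ W | G.Adj u v} : ℝ) = b - δ) :
    ∑ w ∈ W, codensityDiff G A B w = 2 * δ := by
  have key : ∀ D : Finset V, ∑ w ∈ W, (#{a ∈ D | G.Adj a w} : ℝ) =
      ∑ a ∈ D, (#{v ∈ W | G.Adj a v} : ℝ) := by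
    intro D
    exact_mod_cast (Finset.sum_card_bipartiteAbove_eq_sum_card_bipartiteBelow
      (s := D) (t := W) G.Adj).symm
  have hA' : (#A : ℝ) ≠ 0 := by exact_mod_cast hA.card_pos.ne'
  have hB' : (#B : ℝ) ≠ 0 := by exact_mod_cast hB.card_pos.ne'
  simp only [codensityDiff]
  rw [Finset.sum_sub_distrib, ← Finset.sum_div, ← Finset.sum_div, key, key,
    Finset.sum_congr rfl h1, Finset.sum_congr rfl h2, Finset.sum_const, Finset.sum_const]
  simp only [nsmul_eq_mul]
  field_simp
  ring

/-- Both densities to S are within ε of the density of (Z, Z'). -/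
lemma IsRegularPair.sum_codensityDiff_le {ε : ℝ} {Z Z' A B S : Finset V}
    (h : IsRegularPair G ε Z Z') (hAZ : A ⊆ Z) (hBZ : B ⊆ Z) (hS : S ⊆ Z')
    (hA : ε * #Z ≤ #A) (hB : ε * #Z ≤ #B) (hSc : ε * #Z' ≤ #S) :
    ∑ w ∈ S, codensityDiff G A B w ≤ 2 * ε * #S := by
  simp only [codensityDiff]
  rw [Finset.sum_sub_distrib, ← edgeDensity_mul_card, ← edgeDensity_mul_card, ← sub_mul]
  have h1 := abs_le.1 (h A hAZ S hS hA hSc)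
  have h2 := abs_le.1 (h B hBZ S hS hB hSc)
  exact mul_le_mul_of_nonneg_right (by linarith) (by positivity)

end Density

/-- A part exceeds the average by at most one, and there are no more parts than vertices. -/
lemma card_part_mul_card_parts_le {V : Type*} [Fintype V] [DecidableEq V]
    {P : Finpartition (univ : Finset V)} (hP : P.IsEquipartition) {Z : Finset V}
    (hZ : Z ∈ P.parts) : #Z * #P.parts ≤ 2 * Fintype.card V := by
  have h1 := hP.card_part_le_average_add_one hZ
  have h2 := P.card_parts_le_card
  rw [Finset.card_univ] at h1 h2
  calc #Z * #P.parts ≤ (Fintype.card V / #P.parts + 1) * #P.parts := Nat.mul_le_mul_right _ h1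
    _ = Fintype.card V / #P.parts * #P.parts + #P.parts := by ring
    _ ≤ Fintype.card V + Fintype.card V := Nat.add_le_add (Nat.div_mul_le_self _ _) h2
    _ = _ := by ring

/-- In a nice equipartition the parts irregular with a given part carry little mass. -/
lemma IsNiceEquipartition.sum_card_irregular_le {V : Type*} [Fintype V] [DecidableEq V]
    {G : SimpleGraph V} [DecidableRel G.Adj] {ε : ℝ} {P : Finpartition (univ : Finset V)}
    (hP : IsNiceEquipartition G ε P) {Z : Finset V} (hZ : Z ∈ P.parts)
    [DecidablePred fun Z' => IsRegularPair G ε Z Z'] :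
    ∑ Z' ∈ P.parts with ¬ IsRegularPair G ε Z Z', (#Z' : ℝ) ≤ 2 * ε * Fintype.card V := by
  have hirr := hP.2 Z hZ
  have hset : ({Z' | Z' ∈ P.parts ∧ ¬ IsRegularPair G ε Z Z'} : Set (Finset V)) =
      ((P.parts.filter fun Z' => ¬ IsRegularPair G ε Z Z' : Finset (Finset V)) :
        Set (Finset V)) := by
    ext; simp
  rw [hset, Set.ncard_coe_finset] at hirr
  have hk : (0 : ℝ) < #P.parts := by exact_mod_cast Finset.card_pos.2 ⟨Z, hZ⟩
  have hle : ∀ Z' ∈ P.parts.filter (fun Z' => ¬ IsRegularPair G ε Z Z'),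
      (#Z' : ℝ) ≤ 2 * Fintype.card V / #P.parts := by
    intro Z' hZ'
    rw [le_div_iff₀ hk]
    exact_mod_cast card_part_mul_card_parts_le hP.1 (mem_filter.1 hZ').1
  refine (Finset.sum_le_card_nsmul _ _ _ hle).trans ?_
  rw [nsmul_eq_mul]
  refine (mul_le_mul_of_nonneg_right hirr (by positivity)).trans (le_of_eq ?_)
  field_simp

lemma Finpartition.sum_sum_filter {V : Type*} [Fintype V] [DecidableEq V]
    (P : Finpartition (univ : Finset V)) (p : V → Prop) [DecidablePred p] (f : V → ℝ) :
    ∑ Z ∈ P.parts, ∑ w ∈ Z with p w, f w = ∑ w with p w, f w := by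
  simp only [Finset.sum_filter]
  conv_rhs => rw [← P.biUnion_parts]
  rw [Finset.sum_biUnion P.supIndep.pairwiseDisjoint]
  rfl

lemma sum_card_filter_eq {V K : Type*} [Fintype K] [DecidableEq K] (π : V → K) (Z : Finset V) :
    ∑ y, #{w ∈ Z | π w = y} = #Z :=
  (Finset.card_eq_sum_card_fiberwise (fun _ _ => mem_univ _)).symm

lemma card_filter_and_le {V : Type*} (Z : Finset V) (p q : V → Prop) [DecidablePred p]
    [DecidablePred q] : #{w ∈ Z | p w ∧ q w} ≤ #{w ∈ Z | p w} := by
  rw [← Finset.filter_filter]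
  exact Finset.card_filter_le _ _

lemma sum_card_filter_and_eq {V C : Type*} [Fintype C] [DecidableEq C] (τ : V → C)
    (p : V → Prop) [DecidablePred p] (q : C → Prop) [DecidablePred q] (Z : Finset V) :
    ∑ c with q c, #{v ∈ Z | p v ∧ τ v = c} = #{v ∈ Z | p v ∧ q (τ v)} := by
  rw [Finset.card_eq_sum_card_fiberwise (f := τ) (t := univ.filter q)]
  · refine Finset.sum_congr rfl fun c hc => ?_
    congr 1
    ext v
    simp only [mem_filter, mem_univ, true_and] at hc ⊢
    constructor
    · rintro ⟨h1, h2, rfl⟩; exact ⟨⟨h1, h2, hc⟩, rfl⟩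
    · rintro ⟨⟨h1, h2, -⟩, h3⟩; exact ⟨h1, h2, h3⟩
  · intro v hv
    simp only [coe_filter, Set.mem_ofPred_eq, mem_univ, true_and] at hv ⊢
    exact hv.2.2

/-! ### From near containment at one level to the next -/

section Step

variable {V K C : Type*} [Fintype K] [DecidableEq K]

/-- A part which is regular with `Z` sees small total density differences between the two sides
into which the parts of the coarser partition split `Z`. -/
lemma IsRegularPair.sum_sum_codensityDiff_le {G : SimpleGraph V} [DecidableRel G.Adj] {ε β : ℝ}
    (hε : 0 < ε) (π : V → K) (q : V → Prop) [DecidablePred q] {Z Z' : Finset V}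
    (h : IsRegularPair G ε Z Z') (A B : K → Finset V) (good : Finset K)
    (hAZ : ∀ y, A y ⊆ Z) (hBZ : ∀ y, B y ⊆ Z)
    (hgood : ∀ y ∈ good, ε * #Z ≤ #(A y) ∧ ε * #Z ≤ #(B y))
    (hcon : ∃ y, (1 - β) * #Z' ≤ #{v ∈ Z' | π v = y}) :
    ∑ y ∈ good, ∑ w ∈ Z' with π w = y ∧ q w, codensityDiff G (A y) (B y) w ≤
      (3 * ε + β) * #Z' := by
  obtain ⟨y', hy'⟩ := hcon
  have hsub : ∀ y, (#{w ∈ Z' | π w = y ∧ q w} : ℝ) ≤ #{w ∈ Z' | π w = y} := by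
    intro y
    exact_mod_cast card_filter_and_le Z' _ _
  -- A slice too small for regularity is bounded by its size: at most ε|Z'| for the dominant class
  -- y', while all other classes together hold at most β|Z'|.
  have hterm : ∀ y ∈ good, ∑ w ∈ Z' with π w = y ∧ q w, codensityDiff G (A y) (B y) w ≤
      2 * ε * #{w ∈ Z' | π w = y} +
        ((#{w ∈ Z' | π w = y} : ℝ) +
          if y = y' then ε * #Z' - #{w ∈ Z' | π w = y'} else 0) := by
    intro y hy
    have hs := hsub y
    by_cases hc : ε * #Z' ≤ #{w ∈ Z' | π w = y ∧ q w}
    · have h1 := h.sum_codensityDiff_le G (hAZ y) (hBZ y) (Finset.filter_subset _ _)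
        (hgood y hy).1 (hgood y hy).2 hc
      have h2 : 2 * ε * (#{w ∈ Z' | π w = y ∧ q w} : ℝ) ≤ 2 * ε * #{w ∈ Z' | π w = y} :=
        mul_le_mul_of_nonneg_left hs (by linarith)
      have h3 : (0 : ℝ) ≤ (#{w ∈ Z' | π w = y} : ℝ) +
          if y = y' then ε * #Z' - #{w ∈ Z' | π w = y'} else 0 := by
        split_ifs with hyy
        · subst hyy; have : 0 ≤ ε * #Z' := by positivity
          linarith
        · positivity
      linarith
    · have h1 := sum_codensityDiff_le_card G (A y) (B y) {w ∈ Z' | π w = y ∧ q w}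
      have h2 : 0 ≤ 2 * ε * (#{w ∈ Z' | π w = y} : ℝ) := by positivity
      split_ifs with hyy
      · subst hyy; linarith [not_le.1 hc]
      · linarith
  have htot : ∑ y, (#{w ∈ Z' | π w = y} : ℝ) = #Z' := by exact_mod_cast sum_card_filter_eq π Z'
  have hnn : ∀ y, (0 : ℝ) ≤ 2 * ε * #{w ∈ Z' | π w = y} + ((#{w ∈ Z' | π w = y} : ℝ) +
      if y = y' then ε * #Z' - #{w ∈ Z' | π w = y'} else 0) := by
    intro y
    have h2 : 0 ≤ 2 * ε * (#{w ∈ Z' | π w = y} : ℝ) := by positivity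
    have h3 : 0 ≤ ε * (#Z' : ℝ) := by positivity
    have h4 : (0 : ℝ) ≤ #{w ∈ Z' | π w = y} := by positivity
    split_ifs with hyy
    · subst hyy; linarith
    · linarith
  refine (Finset.sum_le_sum hterm).trans ((Finset.sum_le_sum_of_subset_of_nonneg
    (Finset.subset_univ _) fun y _ _ => hnn y).trans ?_)
  rw [Finset.sum_add_distrib, Finset.sum_add_distrib, ← Finset.mul_sum, htot]
  simp only [Finset.sum_ite_eq', mem_univ, if_true]
  linarith

/-- If all parts of a nice equipartition are nearly contained in classes of `π`, then they are
nearly contained in classes of the refinement `(π, τ)`. -/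
theorem IsNiceEquipartition.exists_near_containment [Fintype V] [DecidableEq V] [Fintype C]
    [DecidableEq C] {G : SimpleGraph V} [DecidableRel G.Adj]
    {ε β δ : ℝ} (hε : 0 < ε) (π : V → K) (τ : V → C) (σ : C → K → Bool)
    (hsep : ∀ c c', c ≠ c' → Fintype.card K ≤ 8 * #{y | σ c y ≠ σ c' y}) (b : K → K → ℝ)
    (hdeg : ∀ u y, (#{v | (π v = y ∧ σ (τ v) (π u) = true) ∧ G.Adj u v} : ℝ) =
      b (π u) y + if σ (τ u) y = true then δ else -δ)
    {P : Finpartition (univ : Finset V)} (hP : IsNiceEquipartition G ε P)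
    (hcon : ∀ Z ∈ P.parts, ∃ x, (1 - β) * #Z ≤ #{v ∈ Z | π v = x})
    (hsmall : (5 * ε + β) * Fintype.card V < Fintype.card K * δ / 16)
    (hδ : 0 ≤ δ) {Z : Finset V} (hZ : Z ∈ P.parts) :
    ∃ x c, (1 - (β + 32 * ε)) * #Z ≤ #{v ∈ Z | π v = x ∧ τ v = c} := by
  classical
  by_contra! hno
  obtain ⟨x, hx⟩ := hcon Z hZ
  have hZne : Z.Nonempty := P.nonempty_of_mem_parts hZ
  have hZ0 : (0 : ℝ) < #Z := by exact_mod_cast hZne.card_pos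
  obtain ⟨z, -⟩ := hZne
  have : Nonempty C := ⟨τ z⟩
  set A : K → Finset V := fun y => {v ∈ Z | π v = x ∧ σ (τ v) y = true} with hA
  set B : K → Finset V := fun y => {v ∈ Z | π v = x ∧ σ (τ v) y = false} with hB
  have hsum : ∑ c, (#{v ∈ Z | π v = x ∧ τ v = c} : ℝ) = #{v ∈ Z | π v = x} := by
    have := sum_card_filter_and_eq τ (fun v => π v = x) (fun _ => True) Z
    simp only [Finset.filter_true, and_true] at this
    exact_mod_cast this
  -- The loss 32ε cancels the 1/32 of the splitting lemma, so both pieces reach the regularity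
  -- threshold ε|Z|.
  have hcode := card_div_le_card_splitting σ hsep
    (fun c => (#{v ∈ Z | π v = x ∧ τ v = c} : ℝ)) (fun c => by positivity) (32 * ε * #Z)
    (by positivity) (fun c => by rw [hsum]; linarith [hno x c])
  set good : Finset K := {y | ε * #Z ≤ #(A y) ∧ ε * #Z ≤ #(B y)} with hgood
  have hgcard : (Fintype.card K : ℝ) / 32 ≤ #good := by
    refine hcode.trans (le_of_eq ?_)
    congr 2
    ext y
    have e1 : ∑ c with σ c y = true, (#{v ∈ Z | π v = x ∧ τ v = c} : ℝ) = #(A y) := by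
      exact_mod_cast sum_card_filter_and_eq τ (fun v => π v = x) (fun c => σ c y = true) Z
    have e2 : ∑ c with σ c y = false, (#{v ∈ Z | π v = x ∧ τ v = c} : ℝ) = #(B y) := by
      exact_mod_cast sum_card_filter_and_eq τ (fun v => π v = x) (fun c => σ c y = false) Z
    have e3 : 32 * ε * (#Z : ℝ) / 32 = ε * #Z := by ring
    simp only [mem_filter, mem_univ, true_and, e1, e2, e3, hgood]
  have hne : ∀ y ∈ good, (A y).Nonempty ∧ (B y).Nonempty := by
    intro y hy
    have h := (mem_filter.1 hy).2
    have h0 : 0 < ε * #Z := by positivity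
    constructor <;> rw [← Finset.card_pos] <;> rw [← Nat.cast_pos (α := ℝ)]
    · exact h0.trans_le h.1
    · exact h0.trans_le h.2
  have hW : ∀ y ∈ good, ∑ w with π w = y ∧ σ (τ w) x = true,
      codensityDiff G (A y) (B y) w = 2 * δ := by
    intro y hy
    refine sum_codensityDiff_eq G (hne y hy).1 (hne y hy).2 (b := b x y) ?_ ?_
    · intro u hu
      obtain ⟨-, hu1, hu2⟩ := mem_filter.1 hu
      have := hdeg u y
      rw [hu1, if_pos hu2] at this
      rw [Finset.filter_filter, this]
    · intro u hu
      obtain ⟨-, hu1, hu2⟩ := mem_filter.1 hu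
      have := hdeg u y
      rw [hu1, if_neg (by simp [hu2])] at this
      rw [Finset.filter_filter, this, sub_eq_add_neg]
  -- The contribution of Z' to the total discrepancy, which is computed exactly in `htotal` and
  -- bounded part by part in `hbound`.
  set F : Finset V → ℝ := fun Z' => ∑ y ∈ good,
    ∑ w ∈ Z' with π w = y ∧ σ (τ w) x = true, codensityDiff G (A y) (B y) w with hF
  have htotal : ∑ Z' ∈ P.parts, F Z' = #good * (2 * δ) := by
    rw [hF, Finset.sum_comm, Finset.sum_congr rfl fun y hy =>
      (P.sum_sum_filter _ _).trans (hW y hy), Finset.sum_const, nsmul_eq_mul]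
  have hreg : ∀ Z' ∈ P.parts, IsRegularPair G ε Z Z' → F Z' ≤ (3 * ε + β) * #Z' := by
    intro Z' hZ' h
    exact h.sum_sum_codensityDiff_le hε π _ A B good (fun y => Finset.filter_subset _ _)
      (fun y => Finset.filter_subset _ _) (fun y hy => (mem_filter.1 hy).2) (hcon Z' hZ')
  have hany : ∀ Z' : Finset V, F Z' ≤ #Z' := by
    intro Z'
    calc F Z' ≤ ∑ y ∈ good, (#{w ∈ Z' | π w = y ∧ σ (τ w) x = true} : ℝ) :=
          Finset.sum_le_sum fun y _ => sum_codensityDiff_le_card G _ _ _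
      _ ≤ ∑ y ∈ good, (#{w ∈ Z' | π w = y} : ℝ) := Finset.sum_le_sum fun y _ => by
          exact_mod_cast card_filter_and_le Z' _ _
      _ ≤ ∑ y, (#{w ∈ Z' | π w = y} : ℝ) :=
          Finset.sum_le_sum_of_subset_of_nonneg (Finset.subset_univ _) fun _ _ _ => by positivity
      _ = #Z' := by exact_mod_cast sum_card_filter_eq π Z'
  have hβ : 0 ≤ 3 * ε + β := by
    have h1 : (#{v ∈ Z | π v = x} : ℝ) ≤ #Z := by exact_mod_cast Finset.card_filter_le _ _
    have h2 : (1 - β) * (#Z : ℝ) ≤ 1 * #Z := by linarith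
    have := le_of_mul_le_mul_right h2 hZ0
    linarith
  have hparts : ∑ Z' ∈ P.parts, (#Z' : ℝ) = Fintype.card V := by
    have := P.sum_card_parts
    rw [Finset.card_univ] at this
    exact_mod_cast this
  -- Regular parts give 3ε + β; irregular ones have total mass at most 2ε times the number of
  -- vertices.
  have hbound : ∑ Z' ∈ P.parts, F Z' ≤ (5 * ε + β) * Fintype.card V := by
    have h1 : ∀ Z' ∈ P.parts, F Z' ≤ (3 * ε + β) * #Z' +
        if ¬ IsRegularPair G ε Z Z' then (#Z' : ℝ) else 0 := by
      intro Z' hZ'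
      split_ifs with h
      · linarith [hreg Z' hZ' h]
      · have : 0 ≤ (3 * ε + β) * (#Z' : ℝ) := by positivity
        linarith [hany Z']
    refine (Finset.sum_le_sum h1).trans ?_
    rw [Finset.sum_add_distrib, ← Finset.mul_sum, hparts, ← Finset.sum_filter]
    linarith [hP.sum_card_irregular_le hZ]
  rw [htotal] at hbound
  have := mul_le_mul_of_nonneg_right hgcard (by linarith : 0 ≤ 2 * δ)
  linarith

end Step

/-! ### Hierarchy of classes and its weights -/

lemma sum_filter_equiv_prod {V' V C M : Type*} [Fintype V'] [Fintype V] [Fintype C]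
    [AddCommMonoid M] (e : V' ≃ V × C) (p : V → Prop) [DecidablePred p] (f : V' → M) :
    ∑ v' with p (e v').1, f v' = ∑ v with p v, ∑ c, f (e.symm (v, c)) := by
  rw [Finset.sum_filter, ← e.symm.sum_comp, Fintype.sum_prod_type, Finset.sum_filter]
  refine Finset.sum_congr rfl fun v _ => ?_
  simp only [Equiv.apply_symm_apply]
  split_ifs <;> simp

lemma sum_filter_fiber_equiv_prod {V' V C M : Type*} [Fintype V'] [Fintype V] [Fintype C]
    [DecidableEq V] [AddCommMonoid M] (e : V' ≃ V × C) (y : V) (q : C → Prop) [DecidablePred q]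
    (f : V' → M) :
    ∑ v' with (e v').1 = y ∧ q (e v').2, f v' = ∑ c with q c, f (e.symm (y, c)) := by
  rw [Finset.sum_filter, ← e.symm.sum_comp, Fintype.sum_prod_type, Finset.sum_filter]
  simp only [Equiv.apply_symm_apply, ite_and]
  rw [Finset.sum_eq_single y]
  · simp
  · intro v _ hv; simp [hv]
  · simp

/-- The number of classes in the successive levels of the hierarchy. -/
def levelCard : ℕ → ℕ
  | 0 => 1
  | i + 1 => levelCard i * (2 ^ (levelCard i / 8) * 2)

lemma levelCard_pos (i : ℕ) : 0 < levelCard i := by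
  induction i with
  | zero => exact Nat.one_pos
  | succ i ih => rw [levelCard]; positivity

/-- The factor 16 absorbs the division by 8 in the exponent. Level 4, of size 32, is the first to
reach 16. -/
lemma sixteen_mul_towerNat_le_levelCard (j : ℕ) : 16 * towerNat j ≤ levelCard (j + 4) := by
  induction j with
  | zero => norm_num [levelCard, towerNat]
  | succ j ih =>
    have h1 : towerNat j ≤ levelCard (j + 4) / 8 := by omega
    have h2 : 0 < levelCard (j + 4) / 8 := by
      have : 0 < towerNat j := by cases j <;> simp [towerNat]
      omega
    rw [show j + 1 + 4 = (j + 4) + 1 by ring, levelCard, towerNat]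
    have h3 : 8 ≤ levelCard (j + 4) := by omega
    calc 16 * 2 ^ towerNat j = 8 * (2 ^ towerNat j * 2) := by ring
      _ ≤ levelCard (j + 4) * (2 ^ (levelCard (j + 4) / 8) * 2) :=
          Nat.mul_le_mul h3 (Nat.mul_le_mul_right _ (Nat.pow_le_pow_right (by norm_num) h1))

/-- The reason finer levels leave degrees at coarser levels unchanged. -/
lemma sum_sign_eq_zero {C K : Type*} [Fintype C] (σ : C → K → Bool)
    (hbal : ∀ y, #{c | σ c y = true} = #{c | σ c y = false}) (a : Bool) (x : K) :
    ∑ c, (if a = σ c x then 1 else -1 : ℤ) = 0 := by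
  have h1 : ∑ c, (if σ c x = true then 1 else 0 : ℤ) = ∑ c, (if σ c x = false then 1 else 0) := by
    rw [Finset.sum_boole, Finset.sum_boole, hbal]
  rw [← sub_eq_zero, ← Finset.sum_sub_distrib] at h1
  cases a
  · rw [← neg_eq_zero, ← Finset.sum_neg_distrib, ← h1]
    refine Finset.sum_congr rfl fun c _ => ?_
    cases σ c x <;> simp
  · rw [← h1]
    refine Finset.sum_congr rfl fun c _ => ?_
    cases σ c x <;> simp

lemma two_mul_card_filter_of_balanced {C K : Type*} [Fintype C] (σ : C → K → Bool)
    (hbal : ∀ y, #{c | σ c y = true} = #{c | σ c y = false}) (x : K) :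
    2 * #{c | σ c x = true} = Fintype.card C := by
  have := Finset.card_filter_add_card_filter_not (s := (univ : Finset C)) (fun c => σ c x = true)
  simp only [Bool.not_eq_true, ← hbal, Finset.card_univ] at this
  omega

/-- An integer weighting of the pairs of classes of level `h`, together with the hierarchy of coarser
levels, such that at each level the total weight from a vertex to half of a class depends only on
the classes, up to the sign prescribed by `σ`. -/
theorem exists_hierarchical_weight
    (σ : ∀ i, Fin (2 ^ (levelCard i / 8) * 2) → Fin (levelCard i) → Bool)
    (hbal : ∀ i y, #{c | σ i c y = true} = #{c | σ i c y = false}) (h : ℕ) :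
    ∃ (s : Fin (levelCard h) → Fin (levelCard h) → ℤ)
      (π : ∀ i, Fin (levelCard h) → Fin (levelCard i))
      (τ : ∀ i, Fin (levelCard h) → Fin (2 ^ (levelCard i / 8) * 2)),
      (∀ u v, s u v = s v u) ∧ (∀ u v, |s u v| ≤ h) ∧ (∀ v, π h v = v) ∧
      (∀ i < h, ∀ v, π (i + 1) v = finProdFinEquiv (π i v, τ i v)) ∧
      ∀ i < h, ∃ b : Fin (levelCard i) → Fin (levelCard i) → ℤ, ∀ u y,
        2 * (levelCard i : ℤ) * #{v | π i v = y ∧ σ i (τ i v) (π i u) = true} = levelCard h ∧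
        2 * (levelCard i : ℤ) * ∑ v with π i v = y ∧ σ i (τ i v) (π i u) = true, s u v =
          (b (π i u) y + if σ i (τ i u) y = true then 1 else -1) * levelCard h := by
  induction h with
  | zero =>
    refine ⟨fun _ _ => 0, fun i _ => ⟨0, levelCard_pos i⟩, fun i _ => ⟨0, by positivity⟩,
      by simp, by simp, fun v => ?_, by simp, by simp⟩
    exact Subsingleton.elim (α := Fin 1) _ _
  | succ h ih =>
    obtain ⟨s, π, τ, hsymm, habs, hid, hsucc, hlev⟩ := ih
    set N := 2 ^ (levelCard h / 8) * 2 with hN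
    obtain ⟨e, he⟩ : ∃ e : Fin (levelCard (h + 1)) ≃ Fin (levelCard h) × Fin N,
      ∀ p, e.symm p = finProdFinEquiv p := ⟨finProdFinEquiv.symm, fun _ => rfl⟩
    have hcard : (levelCard (h + 1) : ℤ) = levelCard h * N := by rw [levelCard]; push_cast; rfl
    have hzero : ∀ a x, ∑ c : Fin N, (if a = σ h c x then 1 else -1 : ℤ) = 0 :=
      sum_sign_eq_zero (σ h) (hbal h)
    -- The new top projection is the identity; lower ones factor through the old top level.
    let π' : ∀ i, Fin (levelCard (h + 1)) → Fin (levelCard i) := fun i v =>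
      if hi : i = h + 1 then Fin.cast (congrArg levelCard hi.symm) v else π i (e v).1
    let τ' : ∀ i, Fin (levelCard (h + 1)) → Fin (2 ^ (levelCard i / 8) * 2) := fun i v =>
      if hi : i = h then Fin.cast (by rw [hi]) (e v).2 else τ i (e v).1
    have hπtop : ∀ v, π' (h + 1) v = v := fun v => by simp [π']
    have hπ : ∀ i, i ≠ h + 1 → ∀ v, π' i v = π i (e v).1 := fun i hi v => by simp [π', hi]
    have hτtop : ∀ v, τ' h v = (e v).2 := fun v => by simp [τ']
    have hτ : ∀ i, i ≠ h → ∀ v, τ' i v = τ i (e v).1 := fun i hi v => by simp [τ', hi]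
    clear_value π' τ'
    refine ⟨fun u v => s (e u).1 (e v).1 +
      if σ h (e u).2 (e v).1 = σ h (e v).2 (e u).1 then 1 else -1, π', τ', ?_, ?_, hπtop, ?_, ?_⟩
    · intro u v
      simp only [hsymm (e u).1, eq_comm]
    · intro u v
      refine (abs_add_le _ _).trans ?_
      push_cast
      refine add_le_add (habs _ _) ?_
      split_ifs <;> simp
    · intro i hi v
      rcases Nat.lt_succ_iff_lt_or_eq.1 hi with hi' | rfl
      · rw [hπ _ (by omega), hπ _ (by omega), hτ _ (by omega), hsucc i hi']
      · rw [hπtop, hπ _ (by omega), hid, hτtop, ← he, Prod.mk.eta, Equiv.symm_apply_apply]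
    · intro i hi
      rcases Nat.lt_succ_iff_lt_or_eq.1 hi with hi' | rfl
      -- Older level: the condition ignores the new codeword, over which the new signs sum to zero,
      -- so `b` persists.
      · obtain ⟨b, hb⟩ := hlev i hi'
        refine ⟨b, fun u y => ?_⟩
        obtain ⟨h1, h2⟩ := hb (e u).1 y
        simp only [hπ i (by omega), hτ i (by omega)]
        have hc := sum_filter_equiv_prod e
          (fun v => π i v = y ∧ σ i (τ i v) (π i (e u).1) = true) (fun _ => (1 : ℤ))
        simp only [Finset.sum_const, Finset.card_univ, Fintype.card_fin, nsmul_eq_mul,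
          mul_one] at hc
        have hs := sum_filter_equiv_prod e
          (fun v => π i v = y ∧ σ i (τ i v) (π i (e u).1) = true)
          (fun v => s (e u).1 (e v).1 +
            if σ h (e u).2 (e v).1 = σ h (e v).2 (e u).1 then 1 else -1)
        simp only [Equiv.apply_symm_apply, Finset.sum_add_distrib, hzero,
          Finset.sum_const, Finset.card_univ, Fintype.card_fin, nsmul_eq_mul,
          ← Finset.mul_sum] at hs
        constructor
        · rw [hc]; linear_combination (N : ℤ) * h1 - hcard
        · rw [Finset.sum_add_distrib, hs]
          linear_combination (N : ℤ) * h2 - (b (π i (e u).1) y +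
            if σ i (τ i (e u).1) y = true then 1 else -1) * hcard
      -- New level: on the selected half, v's bit is true, so the new sign is just u's bit at y.
      · refine ⟨s, fun u y => ?_⟩
        simp only [hπ i (by omega), hτtop, hid]
        have hhalf : 2 * (#{c | σ i c (e u).1 = true} : ℤ) = N := by
          have := two_mul_card_filter_of_balanced (σ i) (hbal i) (e u).1
          rw [Fintype.card_fin] at this
          exact_mod_cast this
        have hc := sum_filter_fiber_equiv_prod e y (fun c => σ i c (e u).1 = true)
          (fun _ => (1 : ℤ))
        have hs := sum_filter_fiber_equiv_prod e y (fun c => σ i c (e u).1 = true)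
          (fun v => s (e u).1 (e v).1 +
            if σ i (e u).2 (e v).1 = σ i (e v).2 (e u).1 then 1 else -1)
        simp only [Finset.sum_const, nsmul_eq_mul, mul_one] at hc
        simp only [Equiv.apply_symm_apply] at hs
        rw [hc, hs]
        constructor
        · linear_combination (levelCard i : ℤ) * hhalf - hcard
        · rw [Finset.sum_congr rfl (g := fun _ => s (e u).1 y +
            if σ i (e u).2 y = true then 1 else -1)]
          · rw [Finset.sum_const, nsmul_eq_mul]
            linear_combination (levelCard i : ℤ) * (s (e u).1 y +
              if σ i (e u).2 y = true then 1 else -1) * hhalf - (s (e u).1 y +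
              if σ i (e u).2 y = true then 1 else -1) * hcard
          · intro c hc
            rw [(mem_filter.1 hc).2]

/-! ### Realising the weights by circulant graphs -/

/-- Being at cyclic distance between `1` and `r` from zero. -/
def IsCyclicallySmall {m : ℕ} (r : ℕ) (x : ZMod m) : Prop :=
  (1 ≤ x.val ∧ x.val ≤ r) ∨ (1 ≤ (-x).val ∧ (-x).val ≤ r)

instance {m : ℕ} (r : ℕ) : DecidablePred (IsCyclicallySmall (m := m) r) := fun _ =>
  inferInstanceAs (Decidable (_ ∨ _))

lemma isCyclicallySmall_neg {m r : ℕ} {x : ZMod m} :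
    IsCyclicallySmall r (-x) ↔ IsCyclicallySmall r x := by
  rw [IsCyclicallySmall, IsCyclicallySmall, neg_neg, or_comm]

lemma not_isCyclicallySmall_zero {m r : ℕ} [NeZero m] : ¬ IsCyclicallySmall r (0 : ZMod m) := by
  simp [IsCyclicallySmall]

lemma card_val_mem_Icc {m r : ℕ} [NeZero m] (hr : r < m) :
    #{x : ZMod m | 1 ≤ x.val ∧ x.val ≤ r} = r := by
  conv_rhs => rw [← Nat.add_sub_cancel r 1, ← Nat.card_Icc]
  refine Finset.card_nbij' (fun x => x.val) (fun a => (a : ZMod m)) ?_ ?_ ?_ ?_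
  · intro x hx
    simpa using hx
  · intro a ha
    simp only [coe_Icc, Set.mem_Icc] at ha
    simp only [coe_filter, mem_univ, true_and, Set.mem_ofPred_eq]
    rwa [ZMod.val_natCast, Nat.mod_eq_of_lt (by omega)]
  · intro x _
    simp
  · intro a ha
    simp only [coe_Icc, Set.mem_Icc] at ha
    simp only
    rw [ZMod.val_natCast, Nat.mod_eq_of_lt (by omega)]

/-- The arcs on either side of zero are disjoint because 2r < m. Their symmetry, and the omission of
zero, will make the adjacency symmetric and loopless. -/
lemma card_isCyclicallySmall {m r : ℕ} [NeZero m] (hr : 2 * r < m) :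
    #{x : ZMod m | IsCyclicallySmall r x} = 2 * r := by
  have h1 := card_val_mem_Icc (m := m) (r := r) (by omega)
  have h2 : #{x : ZMod m | 1 ≤ (-x).val ∧ (-x).val ≤ r} = r := by
    refine (Finset.card_equiv (Equiv.neg _) fun x => ?_).trans h1
    simp
  have hset : ({x : ZMod m | IsCyclicallySmall r x} : Finset (ZMod m)) =
      ({x : ZMod m | 1 ≤ x.val ∧ x.val ≤ r} : Finset (ZMod m)) ∪
        ({x : ZMod m | 1 ≤ (-x).val ∧ (-x).val ≤ r} : Finset (ZMod m)) := by
    ext x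
    simp only [mem_union, mem_filter, mem_univ, true_and]
    rfl
  rw [hset, Finset.card_union_of_disjoint, h1, h2, two_mul]
  rw [Finset.disjoint_filter]
  rintro x - ⟨h3, h4⟩ ⟨h5, h6⟩
  have hx : x ≠ 0 := by rintro rfl; simp at h3
  have : NeZero x := ⟨hx⟩
  rw [ZMod.val_neg_of_ne_zero] at h6
  omega

lemma card_isCyclicallySmall_sub {m r : ℕ} [NeZero m] (hr : 2 * r < m) (a : ZMod m) :
    #{x : ZMod m | IsCyclicallySmall r (a - x)} = 2 * r := by
  rw [← card_isCyclicallySmall hr]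
  refine Finset.card_equiv (Equiv.subLeft a) fun x => ?_
  simp

/-- A graph with a hierarchy of equitable vertex partitions such that, at each level, the degree of
a vertex into half of a class depends only on the classes, up to a fixed amount with the sign
prescribed by `σ`. -/
theorem exists_hierarchical_graph
    (σ : ∀ i, Fin (2 ^ (levelCard i / 8) * 2) → Fin (levelCard i) → Bool)
    (hbal : ∀ i y, #{c | σ i c y = true} = #{c | σ i c y = false}) (h : ℕ) (hh : 0 < h) :
    ∃ (n : ℕ) (G : SimpleGraph (Fin n)) (_ : DecidableRel G.Adj)
      (π : ∀ i, Fin n → Fin (levelCard i)) (τ : ∀ i, Fin n → Fin (2 ^ (levelCard i / 8) * 2)),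
      0 < n ∧ (∀ i < h, ∀ v, π (i + 1) v = finProdFinEquiv (π i v, τ i v)) ∧
      (∀ x, #{v | π h v = x} * levelCard h = n) ∧
      ∀ i < h, ∃ b : Fin (levelCard i) → Fin (levelCard i) → ℝ, ∀ u y,
        (#{v | (π i v = y ∧ σ i (τ i v) (π i u) = true) ∧ G.Adj u v} : ℝ) = b (π i u) y +
          if σ i (τ i u) y = true then (n : ℝ) / (8 * h * levelCard i)
          else -((n : ℝ) / (8 * h * levelCard i)) := by
  obtain ⟨s, π, τ, hsymm, habs, hid, hsucc, hlev⟩ := exists_hierarchical_weight σ hbal h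
  have : NeZero (8 * h) := ⟨by omega⟩
  -- As |s| ≤ h, this radius lies in [h, 3h], so 2r < 8h; degree 2r in a fibre of size 8h is density
  -- 1/2 + s/(4h).
  set r : Fin (levelCard h) → Fin (levelCard h) → ℕ := fun u v => (2 * h + s u v).toNat with hr
  have hrs : ∀ u v, (r u v : ℤ) = 2 * h + s u v := fun u v => by
    have := abs_le.1 (habs u v)
    exact Int.toNat_of_nonneg (by linarith)
  have hrlt : ∀ u v, 2 * r u v < 8 * h := fun u v => by
    have h1 := (abs_le.1 (habs u v)).2
    have h2 := hrs u v
    zify at hh ⊢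
    linarith
  have hrsymm : ∀ u v, r u v = r v u := fun u v => by simp only [hr, hsymm]
  clear_value r
  set n := levelCard h * (8 * h) with hn
  have e : Fin n ≃ Fin (levelCard h) × ZMod (8 * h) :=
    Fintype.equivOfCardEq (by simp [hn])
  let G : SimpleGraph (Fin n) :=
    { Adj := fun p q => IsCyclicallySmall (r (e p).1 (e q).1) ((e p).2 - (e q).2)
      symm := ⟨fun p q hpq => by rwa [hrsymm, ← isCyclicallySmall_neg, neg_sub]⟩
      loopless := ⟨fun p hp => by rw [sub_self] at hp; exact not_isCyclicallySmall_zero hp⟩ }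
  have hn0 : 0 < n := Nat.mul_pos (levelCard_pos h) (by omega)
  refine ⟨n, G, fun p q => inferInstanceAs (Decidable (IsCyclicallySmall _ _)),
    fun i v => π i (e v).1, fun i v => τ i (e v).1, hn0, fun i hi v => hsucc i hi _, ?_, ?_⟩
  · intro x
    have hc := sum_filter_equiv_prod e (fun v => π h v = x) (fun _ => 1)
    simp only [hid, Finset.sum_const, Finset.card_univ, ZMod.card, smul_eq_mul, mul_one] at hc
    simp only [hid, hc, Finset.filter_eq', mem_univ, if_true, Finset.card_singleton]
    rw [hn]; ring
  · intro i hi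
    obtain ⟨b, hb⟩ := hlev i hi
    -- Half a class has n / (2 * levelCard i) vertices: base density 1/2 gives the first term,
    -- coarser signs the second.
    refine ⟨fun x y => (n : ℝ) / (2 * levelCard i) * (1 / 2) +
      b x y * ((n : ℝ) / (8 * h * levelCard i)), fun u y => ?_⟩
    obtain ⟨h1, h2⟩ := hb (e u).1 y
    have hdeg : (#{v | (π i (e v).1 = y ∧ σ i (τ i (e v).1) (π i (e u).1) = true) ∧
        IsCyclicallySmall (r (e u).1 (e v).1) ((e u).2 - (e v).2)} : ℤ) =
        ∑ v with π i v = y ∧ σ i (τ i v) (π i (e u).1) = true, (4 * h + 2 * s (e u).1 v) := by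
      have hs := sum_filter_equiv_prod e
        (fun v => π i v = y ∧ σ i (τ i v) (π i (e u).1) = true)
        (fun v => if IsCyclicallySmall (r (e u).1 (e v).1) ((e u).2 - (e v).2) then (1 : ℤ) else 0)
      rw [← Finset.sum_filter, Finset.filter_filter, Finset.sum_const, nsmul_eq_mul, mul_one] at hs
      rw [hs]
      refine Finset.sum_congr rfl fun v _ => ?_
      simp only [Equiv.apply_symm_apply, Finset.sum_boole]
      rw [card_isCyclicallySmall_sub (hrlt _ _)]
      push_cast
      rw [hrs]; ring
    rw [Finset.sum_add_distrib, Finset.sum_const, ← Finset.mul_sum, nsmul_eq_mul] at hdeg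
    set D := #{v | (π i (e v).1 = y ∧ σ i (τ i (e v).1) (π i (e u).1) = true) ∧
        IsCyclicallySmall (r (e u).1 (e v).1) ((e u).2 - (e v).2)} with hD
    have key : (levelCard i : ℤ) * D = levelCard h * (2 * h) +
        (b (π i (e u).1) y + if σ i (τ i (e u).1) y = true then 1 else -1) * levelCard h := by
      linear_combination (levelCard i : ℤ) * hdeg + 2 * (h : ℤ) * h1 + h2
    have keyR : (levelCard i : ℝ) * D = levelCard h * (2 * h) +
        (b (π i (e u).1) y + if σ i (τ i (e u).1) y = true then 1 else -1) * levelCard h := by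
      exact_mod_cast key
    change (D : ℝ) = _
    have hk : (levelCard i : ℝ) ≠ 0 := by exact_mod_cast (levelCard_pos i).ne'
    have hh' : (h : ℝ) ≠ 0 := by exact_mod_cast hh.ne'
    refine mul_left_cancel₀ hk ?_
    have hV : (levelCard h : ℝ) = n / (8 * h) := by
      rw [eq_div_iff (by positivity)]; exact_mod_cast hn.symm
    rw [keyR, hV]
    beta_reduce
    split_ifs <;> field_simp <;> ring

/-! ### Counting parts and choosing the height -/

/-- If every part of a partition is mostly contained in a class, and the classes all have the same
small size, then there are many parts. -/
lemma le_two_mul_card_parts {n k : ℕ} (hn : 0 < n) {K : Type*} [DecidableEq K] (π : Fin n → K)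
    (hcard : ∀ x, #{v | π v = x} * k = n) (P : Finpartition (univ : Finset (Fin n)))
    (hcon : ∀ Z ∈ P.parts, ∃ x, (#Z : ℝ) ≤ 2 * #{v ∈ Z | π v = x}) : k ≤ 2 * #P.parts := by
  have h1 : ∀ Z ∈ P.parts, #Z * k ≤ 2 * n := by
    intro Z hZ
    obtain ⟨x, hx⟩ := hcon Z hZ
    have hx' : #Z ≤ 2 * #{v ∈ Z | π v = x} := by exact_mod_cast hx
    have h2 : #{v ∈ Z | π v = x} ≤ #{v | π v = x} :=
      Finset.card_le_card (Finset.filter_subset_filter _ (Finset.subset_univ _))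
    calc #Z * k ≤ 2 * #{v | π v = x} * k := Nat.mul_le_mul_right _ (by omega)
      _ = 2 * n := by rw [mul_assoc, hcard]
  have h2 := Finset.sum_le_card_nsmul _ _ _ h1
  rw [← Finset.sum_mul, P.sum_card_parts, Finset.card_univ, Fintype.card_fin, smul_eq_mul] at h2
  exact Nat.le_of_mul_le_mul_left (by linarith) hn

lemma height_mul_sqrt_le {ε : ℝ} (hε : 0 < ε) (hε1 : ε < 1 / 10 ^ 6) :
    ((⌈1 / 10 ^ 6 / √ε⌉₊ + 4 : ℕ) : ℝ) * √ε ≤ 1 / 100 := by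
  have hs : 0 < √ε := Real.sqrt_pos.2 hε
  have hs1 : √ε ≤ 1 / 1000 := by
    rw [Real.sqrt_le_left (by norm_num)]
    norm_num at hε1 ⊢
    exact hε1.le
  have hc : (⌈1 / 10 ^ 6 / √ε⌉₊ : ℝ) ≤ 1 / 10 ^ 6 / √ε + 1 :=
    (Nat.ceil_lt_add_one (by positivity)).le
  push_cast
  calc ((⌈1 / 10 ^ 6 / √ε⌉₊ : ℝ) + 4) * √ε ≤ (1 / 10 ^ 6 / √ε + 1 + 4) * √ε := by gcongr
    _ = 1 / 10 ^ 6 + 5 * √ε := by field_simp; ring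
    _ ≤ 1 / 100 := by norm_num at hs1 ⊢; linarith

theorem theorem2 :
    ∃ c : ℝ, 0 < c ∧ ∀ ε : ℝ, 0 < ε → ε < c →
      ∃ (n : ℕ) (G : SimpleGraph (Fin n)) (_ : DecidableRel G.Adj),
        ∀ P : Finpartition (Finset.univ : Finset (Fin n)),
          IsNiceEquipartition G ε P → twr (c / √ε) ≤ P.parts.card := by
  refine ⟨1 / 10 ^ 6, by norm_num, fun ε hε hε1 => ?_⟩
  choose σ hbal hsep using fun i => exists_balanced_code (levelCard i) (levelCard_pos i)
  -- The extra 4 is the lag of the level sizes behind the tower.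
  obtain ⟨h, hdef⟩ : ∃ h, h = ⌈1 / 10 ^ 6 / √ε⌉₊ + 4 := ⟨_, rfl⟩
  have hheight := height_mul_sqrt_le hε hε1
  rw [← hdef] at hheight
  have hh : (1 : ℝ) ≤ h := by exact_mod_cast (by omega : 1 ≤ h)
  -- With β = 32εi, each step needs (5ε + 32εi) * 128h < 1; as i ≤ h and h ≥ 1, it suffices that
  -- 4736 * h²ε < 1.
  have hsq : (h : ℝ) ^ 2 * ε ≤ 1 / 10000 := by
    have h1 : ((h : ℝ) * √ε) ^ 2 ≤ (1 / 100) ^ 2 := by gcongr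
    rw [mul_pow, Real.sq_sqrt hε.le] at h1
    linarith
  have hhε : (h : ℝ) * ε ≤ (h : ℝ) ^ 2 * ε := by
    have : (h : ℝ) ≤ (h : ℝ) ^ 2 := by nlinarith
    exact mul_le_mul_of_nonneg_right this hε.le
  obtain ⟨n, G, hG, π, τ, hn, hsucc, hcard, hdeg⟩ :=
    exists_hierarchical_graph σ hbal h (by omega)
  refine ⟨n, G, hG, fun P hP => ?_⟩
  have hn' : (0 : ℝ) < n := by exact_mod_cast hn
  have hcon : ∀ i ≤ h, ∀ Z ∈ P.parts, ∃ x, (1 - 32 * ε * i) * #Z ≤ (#{v ∈ Z | π i v = x} : ℝ) := by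
    intro i
    induction i with
    | zero =>
      intro _ Z _
      let x : Fin (levelCard 0) := ⟨0, levelCard_pos 0⟩
      have hx : ∀ v ∈ Z, π 0 v = x := fun v _ => Subsingleton.elim (α := Fin 1) _ _
      refine ⟨x, ?_⟩
      rw [Finset.filter_true_of_mem hx]
      simp
    | succ i ih =>
      intro hi Z hZ
      obtain ⟨b, hb⟩ := hdeg i (by omega)
      have hk : (0 : ℝ) < levelCard i := by exact_mod_cast levelCard_pos i
      have hih : (i : ℝ) ≤ h := by exact_mod_cast (by omega : i ≤ h)
      obtain ⟨x, c, hxc⟩ := hP.exists_near_containment hε (π i) (τ i) (σ i)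
        (by simpa only [Fintype.card_fin] using hsep i) b hb (ih (by omega)) (by
          have e1 : (levelCard i : ℝ) * (n / (8 * h * levelCard i)) / 16 = 1 / (128 * h) * n := by
            field_simp; norm_num
          rw [Fintype.card_fin, Fintype.card_fin, e1]
          refine mul_lt_mul_of_pos_right ?_ hn'
          rw [lt_div_iff₀ (by positivity)]
          have : ε * i * h ≤ (h : ℝ) ^ 2 * ε := by
            rw [sq, mul_comm (_ * _) ε, ← mul_assoc]
            gcongr
          linarith) (by positivity) hZ
      let x' : Fin (levelCard (i + 1)) := finProdFinEquiv (x, c)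
      have hx' : ∀ v ∈ Z, π (i + 1) v = x' ↔ π i v = x ∧ τ i v = c := fun v _ => by
        rw [hsucc i (by omega)]
        exact finProdFinEquiv.apply_eq_iff_eq.trans Prod.mk_inj
      refine ⟨x', ?_⟩
      rw [Finset.filter_congr hx']
      push_cast
      rwa [show 32 * ε * ((i : ℝ) + 1) = 32 * ε * i + 32 * ε by ring]
  -- The accumulated loss 32εh is still below 1/2.
  have hlarge := le_two_mul_card_parts hn (π h) hcard P fun Z hZ => by
    obtain ⟨x, hx⟩ := hcon h le_rfl Z hZ
    refine ⟨x, ?_⟩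
    have hZ0 : (0 : ℝ) ≤ #Z := by positivity
    have : 1 / 2 * (#Z : ℝ) ≤ (1 - 32 * ε * h) * #Z :=
      mul_le_mul_of_nonneg_right (by linarith) hZ0
    linarith
  have htower := sixteen_mul_towerNat_le_levelCard ⌈1 / 10 ^ 6 / √ε⌉₊
  rw [← hdef] at htower
  rw [twr]
  omega
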